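/- Let $B=\{B(t)\}_{t\ge 0}$ be a standard Brownian motion (with $B(0)=0$ and continuous paths almost surely) on a probability space $(\Omega,\mathcal F,\mathbb P)$, and let $S(t)=B(t+1)-B(t)$, $t\in[0,1]$, be the associated Slepian process. Let $\phi(x)=\frac{1}{\sqrt{2\pi}}e^{-x^2/2}$ and $\Phi(x)=\int_{-\infty}^{x}\phi(s)\,ds$ be the density and the distribution function of the standard normal distribution. Then for every $a\in\mathbb R$, $$\mathbb P\bigl(S(t)\le a\ \text{for all } t\in[0,1]\bigr)=\Phi(a)^2-a\,\phi(a)\,\Phi(a)-\phi(a)^2 .$$ -/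

import Mathlib

open MeasureTheory ProbabilityTheory
open scoped NNReal

noncomputable section

/-- The density `φ` of the standard normal distribution. -/
def stdNormalPDF (x : ℝ) : ℝ :=
  1 / Real.sqrt (2 * Real.pi) * Real.exp (-x ^ 2 / 2)

/-- The distribution function `Φ(x) = ∫_{-∞}^x φ(s) ds` of the standard normal distribution. -/
def stdNormalCDF (x : ℝ) : ℝ :=
  ∫ s in Set.Iic x, stdNormalPDF s

/-- The increment process `S(t) = B(t + 1) - B(t)` of a process `B` indexed by `[0, ∞)`.
It is the Slepian process when `B` is a standard Brownian motion. -/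
def slepianProcess {Ω : Type*} (B : ℝ≥0 → Ω → ℝ) (t : ℝ≥0) (ω : Ω) : ℝ :=
  B (t + 1) ω - B t ω

end

/-!
# The distribution of the maximum of the Slepian process

Write `S` for the Slepian process on `[0, 1]`. It is a centered Gaussian process with covariance
`1 - |s - t|` (`covariance_slepianProcess`). Hence the endpoints `S 0` and `S 1` are independent
standard normal variables, and the bridge `b t = S t - (1 - t) S 0 - t S 1` is independent of them
(`indepFun_slepianBridge_endpoints`). The probability that `S` exceeds `a` is therefore an average,
over the endpoints, of the crossing probabilities of the bridge.

These crossing probabilities come from the increment `V t = S t - S 0 = b t + t V 1`, which is `√2`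
times a Brownian motion on `[0, 1]`. The reflection principle for `V`
(`map_slepianIncrement_restrict_eq_reflect`) is proved on grids, where the increment of `V` after
the first exceedance is symmetric and independent of the past, and passes to the limit by path
continuity, which makes the overshoot vanish. Conditioning it on the value of `V 1`, which is
independent of `b`, shows that a bridge of variance `2` from `0` to `v < m` exceeds `m > 0` with
probability `exp (-m (m - v))` (`bridgeCrossingProb_ae_eq`).

Consequently `S` stays below `a` with probability `Φ(a)²`, that of both endpoints lying below `a`,
minus `∫∫ exp (-(a - x) (a - y)) φ(x) φ(y) dx dy` over `x, y ≤ a`. Since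
`φ(x) φ(y) exp (-(a - x) (a - y)) = φ(a) φ(x + y - a)`, this double integral is
`φ(a) ∫ Φ(x) dx` over `x ≤ a`, that is `φ(a) (a Φ(a) + φ(a))`
(`lintegral_gaussianReal_exp_bridge`).
-/

open Filter Topology Set
open scoped ENNReal

/-! ### The normal distribution -/

lemma stdNormalPDF_eq_gaussianPDFReal : stdNormalPDF = gaussianPDFReal 0 1 := by
  funext x
  simp [stdNormalPDF, gaussianPDFReal]

lemma stdNormalPDF_pos (x : ℝ) : 0 < stdNormalPDF x := by
  rw [stdNormalPDF_eq_gaussianPDFReal]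
  exact gaussianPDFReal_pos 0 1 x one_ne_zero

lemma integrable_stdNormalPDF : Integrable stdNormalPDF := by
  rw [stdNormalPDF_eq_gaussianPDFReal]
  exact integrable_gaussianPDFReal 0 1

lemma hasDerivAt_stdNormalPDF (x : ℝ) : HasDerivAt stdNormalPDF (-x * stdNormalPDF x) x := by
  unfold stdNormalPDF
  have h : HasDerivAt (fun x : ℝ ↦ -x ^ 2 / 2) (-x) x := by
    refine (((hasDerivAt_id x).pow 2).neg.div_const 2).congr_deriv ?_
    simp
    ring
  exact (h.exp.const_mul _).congr_deriv (by ring)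

lemma continuous_stdNormalPDF : Continuous stdNormalPDF :=
  continuous_iff_continuousAt.2 fun x ↦ (hasDerivAt_stdNormalPDF x).continuousAt

lemma integrable_neg_id_mul_stdNormalPDF : Integrable fun x ↦ -x * stdNormalPDF x := by
  have := (integrable_mul_exp_neg_mul_sq (b := 1 / 2) (by norm_num)).const_mul
    (-(1 / √(2 * Real.pi)))
  refine this.congr (ae_of_all _ fun x ↦ ?_)
  simp only [stdNormalPDF]
  rw [show -(1 / 2) * x ^ 2 = -x ^ 2 / 2 by ring]
  ring

lemma tendsto_stdNormalPDF_atBot : Tendsto stdNormalPDF atBot (𝓝 0) :=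
  tendsto_zero_of_hasDerivAt_of_integrableOn_Iic (a := 0) (fun x _ ↦ hasDerivAt_stdNormalPDF x)
    integrable_neg_id_mul_stdNormalPDF.integrableOn integrable_stdNormalPDF.integrableOn

lemma stdNormalCDF_nonneg (x : ℝ) : 0 ≤ stdNormalCDF x :=
  integral_nonneg fun s ↦ (stdNormalPDF_pos s).le

lemma hasDerivAt_stdNormalCDF (x : ℝ) : HasDerivAt stdNormalCDF (stdNormalPDF x) x := by
  have h : stdNormalCDF = fun x ↦ stdNormalCDF 0 + ∫ s in (0 : ℝ)..x, stdNormalPDF s := by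
    funext x
    rw [← intervalIntegral.integral_Iic_sub_Iic integrable_stdNormalPDF.integrableOn
      integrable_stdNormalPDF.integrableOn]
    simp [stdNormalCDF]
  rw [h]
  exact (continuous_stdNormalPDF.integral_hasStrictDerivAt 0 x).hasDerivAt.const_add _

lemma continuous_stdNormalCDF : Continuous stdNormalCDF :=
  continuous_iff_continuousAt.2 fun x ↦ (hasDerivAt_stdNormalCDF x).continuousAt

/-- The Mills-type tail bound `|x| Φ(x) ≤ φ(x)` for `x ≤ 0`. -/
lemma neg_mul_stdNormalCDF_le (x : ℝ) : -x * stdNormalCDF x ≤ stdNormalPDF x := by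
  calc -x * stdNormalCDF x = ∫ s in Iic x, -x * stdNormalPDF s := by
        rw [stdNormalCDF, integral_const_mul]
    _ ≤ ∫ s in Iic x, -s * stdNormalPDF s := by
        refine setIntegral_mono_on (integrable_stdNormalPDF.const_mul _).integrableOn
          integrable_neg_id_mul_stdNormalPDF.integrableOn measurableSet_Iic fun s hs ↦ ?_
        exact mul_le_mul_of_nonneg_right (neg_le_neg hs) (stdNormalPDF_pos s).le
    _ = stdNormalPDF x := by
        rw [integral_Iic_of_hasDerivAt_of_tendsto' (fun s _ ↦ hasDerivAt_stdNormalPDF s)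
          integrable_neg_id_mul_stdNormalPDF.integrableOn tendsto_stdNormalPDF_atBot, sub_zero]

lemma hasDerivAt_mul_stdNormalCDF_add (x : ℝ) :
    HasDerivAt (fun x ↦ x * stdNormalCDF x + stdNormalPDF x) (stdNormalCDF x) x := by
  refine (((hasDerivAt_id x).mul (hasDerivAt_stdNormalCDF x)).add
    (hasDerivAt_stdNormalPDF x)).congr_deriv ?_
  simp

lemma tendsto_mul_stdNormalCDF_add_atBot :
    Tendsto (fun x ↦ x * stdNormalCDF x + stdNormalPDF x) atBot (𝓝 0) := by
  refine tendsto_of_tendsto_of_tendsto_of_le_of_le' tendsto_const_nhds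
    tendsto_stdNormalPDF_atBot ?_ ?_
  · filter_upwards with x
    linarith [neg_mul_stdNormalCDF_le x]
  · filter_upwards [eventually_le_atBot 0] with x hx
    linarith [mul_nonpos_of_nonpos_of_nonneg hx (stdNormalCDF_nonneg x)]

lemma integrableOn_stdNormalCDF_Iic (a : ℝ) : IntegrableOn stdNormalCDF (Iic a) := by
  refine integrableOn_Iic_of_intervalIntegral_norm_tendsto
    (a * stdNormalCDF a + stdNormalPDF a - 0) a
    (fun i : ℝ ↦ (continuous_stdNormalCDF.integrableOn_Icc (a := i) (b := a)).mono_set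
      Ioc_subset_Icc_self) tendsto_id ?_
  refine (tendsto_mul_stdNormalCDF_add_atBot.const_sub _).congr fun i ↦ ?_
  simp_rw [Real.norm_of_nonneg (stdNormalCDF_nonneg _)]
  exact (intervalIntegral.integral_eq_sub_of_hasDerivAt
    (fun x _ ↦ hasDerivAt_mul_stdNormalCDF_add x)
    (continuous_stdNormalCDF.intervalIntegrable _ _)).symm

lemma integral_stdNormalCDF_Iic (a : ℝ) :
    ∫ x in Iic a, stdNormalCDF x = a * stdNormalCDF a + stdNormalPDF a := by
  rw [integral_Iic_of_hasDerivAt_of_tendsto' (fun x _ ↦ hasDerivAt_mul_stdNormalCDF_add x)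
    (integrableOn_stdNormalCDF_Iic a) tendsto_mul_stdNormalCDF_add_atBot, sub_zero]

lemma gaussianReal_Iic (a : ℝ) : gaussianReal 0 1 (Iic a) = ENNReal.ofReal (stdNormalCDF a) := by
  rw [gaussianReal_apply_eq_integral _ one_ne_zero, ← stdNormalPDF_eq_gaussianPDFReal]
  rfl

/-- Completing the square: this turns the bridge crossing probability, weighted by the density of
the endpoints, into a single Gaussian density. -/
lemma stdNormalPDF_mul_stdNormalPDF_mul_exp (a x y : ℝ) :
    stdNormalPDF x * (stdNormalPDF y * Real.exp (-((a - x) * (a - y)))) =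
      stdNormalPDF a * stdNormalPDF (y + (x - a)) := by
  simp only [stdNormalPDF]
  have h : Real.exp (-x ^ 2 / 2) * (Real.exp (-y ^ 2 / 2) * Real.exp (-((a - x) * (a - y)))) =
      Real.exp (-a ^ 2 / 2) * Real.exp (-(y + (x - a)) ^ 2 / 2) := by
    rw [← Real.exp_add, ← Real.exp_add, ← Real.exp_add]
    ring_nf
  linear_combination (1 / √(2 * Real.pi)) ^ 2 * h

/-- The Gaussian average, over endpoints below `a`, of the probability that a bridge of variance `2`
between them crosses `a`: by `stdNormalPDF_mul_stdNormalPDF_mul_exp` the inner integral is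
`φ(a) Φ(x)`, and `x ↦ x Φ(x) + φ(x)` is a primitive of `Φ`. -/
lemma lintegral_gaussianReal_exp_bridge (a : ℝ) :
    ∫⁻ x in Iic a, ∫⁻ y in Iic a, ENNReal.ofReal (Real.exp (-((a - x) * (a - y))))
      ∂gaussianReal 0 1 ∂gaussianReal 0 1 =
      ENNReal.ofReal (stdNormalPDF a * (a * stdNormalCDF a + stdNormalPDF a)) := by
  have hpdf : gaussianPDF 0 1 = fun x ↦ ENNReal.ofReal (stdNormalPDF x) := by
    rw [gaussianPDF_def, stdNormalPDF_eq_gaussianPDFReal]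
  have hm : Measurable fun x ↦ ENNReal.ofReal (stdNormalPDF x) :=
    continuous_stdNormalPDF.measurable.ennreal_ofReal
  have hinner (x : ℝ) : ENNReal.ofReal (stdNormalPDF x) *
      ∫⁻ y in Iic a, ENNReal.ofReal (Real.exp (-((a - x) * (a - y)))) ∂gaussianReal 0 1 =
      ENNReal.ofReal (stdNormalPDF a * stdNormalCDF x) := by
    rw [gaussianReal_of_var_ne_zero _ one_ne_zero, hpdf,
      setLIntegral_withDensity_eq_setLIntegral_mul _ hm (by fun_prop) measurableSet_Iic,
      ← lintegral_const_mul _ (by fun_prop)]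
    simp only [Pi.mul_apply]
    have hpt (y : ℝ) : ENNReal.ofReal (stdNormalPDF x) * (ENNReal.ofReal (stdNormalPDF y) *
        ENNReal.ofReal (Real.exp (-((a - x) * (a - y))))) =
        ENNReal.ofReal (stdNormalPDF a * stdNormalPDF (y + (x - a))) := by
      rw [← ENNReal.ofReal_mul (stdNormalPDF_pos y).le,
        ← ENNReal.ofReal_mul (stdNormalPDF_pos x).le, stdNormalPDF_mul_stdNormalPDF_mul_exp]
    simp_rw [hpt]
    rw [← ofReal_integral_eq_lintegral_ofReal
      ((integrable_stdNormalPDF.comp_add_right (x - a)).const_mul _).integrableOn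
      (ae_of_all _ fun y ↦ (mul_pos (stdNormalPDF_pos a) (stdNormalPDF_pos _)).le),
      integral_const_mul]
    congr 2
    have hshift := (measurePreserving_add_right volume (x - a)).setIntegral_preimage_emb
      (measurableEmbedding_addRight (x - a)) stdNormalPDF (Iic x)
    rwa [preimage_add_const_Iic, sub_sub_cancel] at hshift
  have hΦ : Measurable fun x ↦
      ∫⁻ y in Iic a, ENNReal.ofReal (Real.exp (-((a - x) * (a - y)))) ∂gaussianReal 0 1 :=
    Measurable.lintegral_prod_right' (f := fun p : ℝ × ℝ ↦
      ENNReal.ofReal (Real.exp (-((a - p.1) * (a - p.2))))) (by fun_prop)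
  calc _ = ∫⁻ x in Iic a, ENNReal.ofReal (stdNormalPDF a * stdNormalCDF x) := by
        simp_rw [← hinner]
        conv_lhs => rw [gaussianReal_of_var_ne_zero _ one_ne_zero, hpdf]
        rw [setLIntegral_withDensity_eq_setLIntegral_mul _ hm ?_ measurableSet_Iic]
        · rw [gaussianReal_of_var_ne_zero _ one_ne_zero, hpdf]
          rfl
        · have := hΦ
          rwa [gaussianReal_of_var_ne_zero _ one_ne_zero, hpdf] at this
    _ = _ := by
        rw [← ofReal_integral_eq_lintegral_ofReal ((integrableOn_stdNormalCDF_Iic a).const_mul _)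
          (ae_of_all _ fun x ↦ mul_nonneg (stdNormalPDF_pos a).le (stdNormalCDF_nonneg x)),
          integral_const_mul, integral_stdNormalCDF_Iic]

/-! ### First exceedance of a level on a grid -/

/-- On the grid of mesh `1 / (n + 1)`, the path `v` exceeds the level `m` for the first time at the
`k`-th grid point. -/
def IsFirstExceedance (m : ℝ) (v : ℝ≥0 → ℝ) (n k : ℕ) : Prop :=
  m < v (k / (n + 1)) ∧ ∀ j < k, v (j / (n + 1)) ≤ m

lemma eventually_exists_grid_lt {v : ℝ≥0 → ℝ} (hv : Continuous v) {m : ℝ} {t : ℝ≥0} (ht : t ≤ 1)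
    (hm : m < v t) : ∀ᶠ n : ℕ in atTop, ∃ k ≤ n + 1, m < v (k / (n + 1)) := by
  have h2 : Tendsto (fun n : ℕ ↦ v (⌊t * ((n : ℝ≥0) + 1)⌋₊ / ((n : ℝ≥0) + 1))) atTop (𝓝 (v t)) := by
    refine (hv.tendsto t).comp ?_
    refine NNReal.tendsto_coe.1 ?_
    have h3 : Tendsto (fun n : ℕ ↦ (n : ℝ) + 1) atTop atTop :=
      tendsto_atTop_add_const_right _ _ tendsto_natCast_atTop_atTop
    refine ((tendsto_nat_floor_mul_div_atTop (R := ℝ) t.coe_nonneg).comp h3).congr fun n ↦ ?_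
    simp only [Function.comp_apply, NNReal.coe_div, NNReal.coe_natCast, NNReal.coe_add,
      NNReal.coe_one]
    congr 2
  filter_upwards [h2.eventually_const_lt hm] with n hn
  refine ⟨_, ?_, hn⟩
  refine Nat.floor_le_of_le ?_
  push_cast
  exact mul_le_of_le_one_left zero_le ht

/-- An enumeration of the rational points of `[0, 1]`: the `k`-th point of the grid of mesh
`1 / (n + 1)`, truncated at `1`. -/
noncomputable def gridTime (p : ℕ × ℕ) : ℝ≥0 := min (p.2 / (p.1 + 1)) 1

lemma gridTime_le_one (p : ℕ × ℕ) : gridTime p ≤ 1 := min_le_right _ _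

lemma gridTime_zero_zero : gridTime (0, 0) = 0 := by simp [gridTime]

lemma gridTime_zero_one : gridTime (0, 1) = 1 := by simp [gridTime]

lemma grid_le_one {n k : ℕ} (hk : k ≤ n + 1) : (k : ℝ≥0) / (n + 1) ≤ 1 :=
  div_le_one_of_le₀ (by exact_mod_cast hk) zero_le

lemma forall_gridTime_le_iff {v : ℝ≥0 → ℝ} (hv : Continuous v) {m : ℝ} :
    (∀ i, v (gridTime i) ≤ m) ↔ ∀ t ∈ Icc (0 : ℝ≥0) 1, v t ≤ m := by
  refine ⟨fun h t ht ↦ ?_, fun h i ↦ h _ ⟨zero_le, gridTime_le_one i⟩⟩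
  by_contra! hlt
  obtain ⟨n, k, hk, hn⟩ := (eventually_exists_grid_lt hv ht.2 hlt).exists
  have hle := h (n, k)
  rw [gridTime, min_eq_left (grid_le_one hk)] at hle
  exact hle.not_gt hn

/-- The value of a continuous path at its first exceedance of the level `m` on a grid tends to `m`
as the mesh tends to `0`. -/
lemma tendsto_sum_indicator_firstExceedance {v : ℝ≥0 → ℝ} (hv : Continuous v) {m : ℝ}
    (h0 : v 0 ≤ m) (hex : ∃ t ∈ Icc (0 : ℝ≥0) 1, m < v t) {h : ℝ → ℝ} (hh : ContinuousAt h m) :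
    Tendsto (fun n : ℕ ↦ ∑ k ∈ Finset.range (n + 2),
      {v | IsFirstExceedance m v n k}.indicator (fun v ↦ h (v (k / (n + 1)))) v)
      atTop (𝓝 (h m)) := by
  obtain ⟨t, ht, hmt⟩ := hex
  have hu : UniformContinuousOn v (Icc 0 1) :=
    isCompact_Icc.uniformContinuousOn_of_continuous hv.continuousOn
  rw [Metric.tendsto_atTop']
  intro ε hε
  obtain ⟨δ, hδ, hδh⟩ := Metric.continuousAt_iff.1 hh ε hε
  obtain ⟨η, hη, hηv⟩ := Metric.uniformContinuousOn_iff.1 hu δ hδ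
  have hmesh : ∀ᶠ n : ℕ in atTop, 1 / ((n : ℝ) + 1) < η :=
    tendsto_one_div_add_atTop_nhds_zero_nat.eventually_lt_const hη
  obtain ⟨N, hN⟩ := eventually_atTop.1 (hmesh.and (eventually_exists_grid_lt hv ht.2 hmt))
  refine ⟨N, fun n hn ↦ ?_⟩
  obtain ⟨hn1, hn2⟩ := hN n hn.le
  classical
  have hex : ∃ k : ℕ, m < v (k / (n + 1)) := hn2.imp fun _ h ↦ h.2
  set k := Nat.find hex with hk
  have hfirst : IsFirstExceedance m v n k :=
    ⟨Nat.find_spec hex, fun j hj ↦ not_lt.1 (Nat.find_min hex hj)⟩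
  have hkn : k ≤ n + 1 := by
    obtain ⟨k', hk', hlt⟩ := hn2
    exact (Nat.find_min' hex hlt).trans hk'
  have hsum : ∑ k ∈ Finset.range (n + 2),
      {v | IsFirstExceedance m v n k}.indicator (fun v ↦ h (v (k / (n + 1)))) v =
      h (v (k / (n + 1))) := by
    rw [Finset.sum_eq_single k]
    · exact indicator_of_mem (s := {v | IsFirstExceedance m v n k}) hfirst _
    · intro j _ hjk
      refine indicator_of_notMem (s := {v | IsFirstExceedance m v n j}) (fun hj ↦ ?_) _
      rcases lt_or_gt_of_ne hjk with hlt | hlt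
      · exact (hfirst.2 j hlt).not_gt hj.1
      · exact (hj.2 k hlt).not_gt hfirst.1
    · intro hk
      exact absurd (Finset.mem_range.2 (by omega)) hk
  rw [hsum]
  refine hδh ?_
  -- The path is at most `m` at the grid point preceding the first exceedance, so uniform continuity
  -- bounds the overshoot.
  have hk0 : k ≠ 0 := by
    intro hk0
    have := hfirst.1
    rw [hk0] at this
    simp only [Nat.cast_zero, zero_div] at this
    exact h0.not_gt this
  obtain ⟨j, hj⟩ := Nat.exists_eq_succ_of_ne_zero hk0
  have hjm : v (j / (n + 1)) ≤ m := hfirst.2 j (by omega)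
  have hkm := hfirst.1
  have hdist : dist (v (k / (n + 1))) (v (j / (n + 1))) < δ := by
    refine hηv _ ⟨zero_le, grid_le_one hkn⟩ _ ⟨zero_le, grid_le_one (by omega)⟩ ?_
    rw [NNReal.dist_eq]
    have : ((k / (n + 1) : ℝ≥0) : ℝ) - ((j / (n + 1) : ℝ≥0) : ℝ) = 1 / ((n : ℝ) + 1) := by
      rw [hj]
      push_cast
      ring
    rw [this, abs_of_pos (by positivity)]
    exact hn1
  rw [Real.dist_eq, abs_lt] at hdist ⊢
  constructor <;> linarith

lemma sum_indicator_firstExceedance_eq_zero {v : ℝ≥0 → ℝ} {m : ℝ}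
    (hle : ∀ t ∈ Icc (0 : ℝ≥0) 1, v t ≤ m) (h : ℝ → ℝ) (n : ℕ) :
    ∑ k ∈ Finset.range (n + 2),
      {v | IsFirstExceedance m v n k}.indicator (fun v ↦ h (v (k / (n + 1)))) v = 0 := by
  refine Finset.sum_eq_zero fun k hk ↦ indicator_of_notMem (fun hmem ↦ ?_) _
  have := Finset.mem_range.1 hk
  exact (hle (k / (n + 1)) ⟨zero_le, grid_le_one (by omega)⟩).not_gt hmem.1

/-- At most one summand is nonzero. -/
lemma abs_sum_indicator_firstExceedance_le {v : ℝ≥0 → ℝ} {m C : ℝ} {h : ℝ → ℝ}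
    (hC : ∀ x, |h x| ≤ C) (n : ℕ) (s : Finset ℕ) :
    |∑ k ∈ s, {v | IsFirstExceedance m v n k}.indicator (fun v ↦ h (v (k / (n + 1)))) v| ≤ C := by
  have hC0 : 0 ≤ C := (abs_nonneg _).trans (hC 0)
  by_cases hs : ∃ k ∈ s, IsFirstExceedance m v n k
  · obtain ⟨k, hks, hk⟩ := hs
    rw [Finset.sum_eq_single_of_mem k hks]
    · rw [indicator_of_mem (s := {v | IsFirstExceedance m v n k}) hk]
      exact hC _
    · intro j _ hjk
      refine indicator_of_notMem (s := {v | IsFirstExceedance m v n j}) (fun hj ↦ ?_) _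
      rcases lt_or_gt_of_ne hjk with hlt | hlt
      · exact (hk.2 j hlt).not_gt hj.1
      · exact (hj.2 k hlt).not_gt hk.1
  · rw [Finset.sum_eq_zero]
    · simpa using hC0
    · exact fun k hk ↦ indicator_of_notMem (s := {v | IsFirstExceedance m v n k})
        (fun h ↦ hs ⟨k, hk, h⟩) _

/-! ### The Slepian process as a Gaussian process -/

/-- A family of linear combinations of the values of a Gaussian process is a Gaussian process. -/
lemma isGaussianProcess_of_mem_span {Ω S T : Type*} {mΩ : MeasurableSpace Ω} {P : Measure Ω}
    {X : T → Ω → ℝ} (hX : IsGaussianProcess X P) {Y : S → Ω → ℝ}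
    (hY : ∀ s, Y s ∈ Submodule.span ℝ (range X)) : IsGaussianProcess Y P := by
  refine hX.of_isGaussianProcess fun s ↦ ?_
  obtain ⟨c, hc⟩ := Finsupp.mem_span_range_iff_exists_finsupp.1 (hY s)
  refine ⟨c.support, ∑ i : c.support, c i • ContinuousLinearMap.proj i, fun ω ↦ ?_⟩
  rw [← hc]
  simp only [Finsupp.sum, Finset.sum_apply, Pi.smul_apply, smul_eq_mul,
    FunLike.coe_sum, FunLike.coe_smul, ContinuousLinearMap.proj_apply,
    Finset.restrict_def]
  exact (Finset.sum_coe_sort c.support fun i ↦ c i * X i ω).symm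

/-- If `U` is symmetric and independent of `Z`, then the law of `(Z, U)` is invariant under
`U ↦ -U`. -/
lemma integral_comp_prodMk_neg_of_indepFun {Ω α : Type*} {mΩ : MeasurableSpace Ω}
    [MeasurableSpace α] {P : Measure Ω} [IsProbabilityMeasure P] {Z : Ω → α} {U : Ω → ℝ}
    (hZ : AEMeasurable Z P) (hU : AEMeasurable U P) (hind : IndepFun Z U P)
    (hsymm : P.map U = P.map (-U)) {Ψ : α × ℝ → ℝ} (hΨ : Measurable Ψ) :
    ∫ ω, Ψ (Z ω, U ω) ∂P = ∫ ω, Ψ (Z ω, -U ω) ∂P := by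
  have h1 := hind.map_prod_eq_prod_map_map hZ hU
  have h2 := (hind.comp measurable_id measurable_neg).map_prod_eq_prod_map_map hZ hU.neg
  have h3 : P.map (fun ω ↦ (Z ω, U ω)) = P.map (fun ω ↦ (Z ω, -U ω)) := by
    rw [h1, hsymm]
    exact h2.symm
  rw [← integral_map (φ := fun ω ↦ (Z ω, U ω)) (hZ.prodMk hU) hΨ.aestronglyMeasurable, h3]
  exact integral_map (hZ.prodMk hU.neg) hΨ.aestronglyMeasurable

section Slepian

variable {Ω : Type*} {mΩ : MeasurableSpace Ω} {P : Measure Ω} {B : ℝ≥0 → Ω → ℝ}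

lemma isGaussianProcess_slepianProcess (hB : IsPreBrownianReal B P) :
    IsGaussianProcess (slepianProcess B) P :=
  isGaussianProcess_of_mem_span hB.isGaussianProcess fun t ↦
    Submodule.sub_mem _ (Submodule.subset_span ⟨t + 1, rfl⟩) (Submodule.subset_span ⟨t, rfl⟩)

lemma memLp_slepianProcess (hB : IsPreBrownianReal B P) (t : ℝ≥0) :
    MemLp (slepianProcess B t) 2 P :=
  ((isGaussianProcess_slepianProcess hB).hasGaussianLaw_eval t).memLp_two

lemma aemeasurable_slepianProcess (hB : IsPreBrownianReal B P) (t : ℝ≥0) :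
    AEMeasurable (slepianProcess B t) P :=
  (isGaussianProcess_slepianProcess hB).aemeasurable t

lemma integral_slepianProcess (hB : IsPreBrownianReal B P) (t : ℝ≥0) :
    ∫ ω, slepianProcess B t ω ∂P = 0 := by
  simp_rw [slepianProcess]
  rw [integral_sub (hB.integrable_eval _) (hB.integrable_eval _), hB.integral_eval,
    hB.integral_eval, sub_zero]

lemma map_slepianProcess (hB : IsPreBrownianReal B P) (t : ℝ≥0) :
    P.map (slepianProcess B t) = gaussianReal 0 1 := by
  have h := (hB.hasLaw_sub (t + 1) t).map_eq
  have h1 : nndist (t + 1).1 t.1 = 1 := by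
    rw [← NNReal.coe_inj, coe_nndist, Real.dist_eq]
    simp
  rw [h1] at h
  exact h

/-- The covariance of the Slepian process. -/
lemma covariance_slepianProcess [IsProbabilityMeasure P] (hB : IsPreBrownianReal B P) {s t : ℝ≥0}
    (hs : s ≤ 1) (ht : t ≤ 1) :
    cov[slepianProcess B s, slepianProcess B t; P] = 1 - |(s : ℝ) - t| := by
  have hL (u : ℝ≥0) : MemLp (B u) 2 P := (hB.isGaussianProcess.hasGaussianLaw_eval u).memLp_two
  have hs' : (s : ℝ) ≤ 1 := hs
  have ht' : (t : ℝ) ≤ 1 := ht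
  have hs0 := s.coe_nonneg
  have ht0 := t.coe_nonneg
  change cov[fun ω ↦ B (s + 1) ω - B s ω, fun ω ↦ B (t + 1) ω - B t ω; P] = _
  rw [covariance_fun_sub_fun_sub (hL _) (hL _) (hL _) (hL _)]
  simp_rw [hB.covariance_fun_eval]
  push_cast
  rw [min_eq_right (by linarith : (t : ℝ) ≤ s + 1), min_eq_left (by linarith : (s : ℝ) ≤ t + 1),
    min_add_add_right]
  rcases le_total (s : ℝ) t with h | h
  · rw [min_eq_left h, abs_of_nonpos (by linarith)]
    ring
  · rw [min_eq_right h, abs_of_nonneg (by linarith)]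
    ring

/-- The Brownian bridge, with variance `2 t (1 - t)` at time `t`, obtained from the Slepian
process on `[0, 1]` by subtracting the linear interpolation of its endpoints. -/
noncomputable def slepianBridge (B : ℝ≥0 → Ω → ℝ) (t : ℝ≥0) (ω : Ω) : ℝ :=
  slepianProcess B t ω - (1 - t) * slepianProcess B 0 ω - t * slepianProcess B 1 ω

lemma slepianBridge_mem_span (B : ℝ≥0 → Ω → ℝ) (t : ℝ≥0) :
    slepianBridge B t ∈ Submodule.span ℝ (range (slepianProcess B)) :=
  Submodule.sub_mem _ (Submodule.sub_mem _ (Submodule.subset_span ⟨t, rfl⟩)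
    (Submodule.smul_mem _ (1 - (t : ℝ)) (Submodule.subset_span ⟨0, rfl⟩)))
    (Submodule.smul_mem _ (t : ℝ) (Submodule.subset_span ⟨1, rfl⟩))

lemma aemeasurable_slepianBridge (hB : IsPreBrownianReal B P) (t : ℝ≥0) :
    AEMeasurable (slepianBridge B t) P :=
  ((aemeasurable_slepianProcess hB t).sub ((aemeasurable_slepianProcess hB 0).const_mul _)).sub
    ((aemeasurable_slepianProcess hB 1).const_mul _)

lemma indepFun_slepianBridge_endpoints [IsProbabilityMeasure P] (hB : IsPreBrownianReal B P)
    {ι : Type*} {τ : ι → ℝ≥0} (hτ : ∀ i, τ i ≤ 1) :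
    IndepFun (fun ω ↦ (slepianProcess B 0 ω, slepianProcess B 1 ω))
      (fun ω i ↦ slepianBridge B (τ i) ω) P := by
  have hL := memLp_slepianProcess hB
  have hL' (c : ℝ) (t : ℝ≥0) : MemLp (fun ω ↦ c * slepianProcess B t ω) 2 P := (hL t).const_mul c
  have key : IndepFun (fun ω (e : Bool) ↦ slepianProcess B (bif e then 1 else 0) ω)
      (fun ω i ↦ slepianBridge B (τ i) ω) P := by
    refine IsGaussianProcess.indepFun_of_covariance_eq_zero
      (X := fun (e : Bool) ω ↦ slepianProcess B (bif e then 1 else 0) ω)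
      (Y := fun i ω ↦ slepianBridge B (τ i) ω)
      (isGaussianProcess_of_mem_span (isGaussianProcess_slepianProcess hB) ?_)
      (fun _ ↦ aemeasurable_slepianProcess hB _) (fun _ ↦ aemeasurable_slepianBridge hB _)
      fun e i ↦ ?_
    · rintro (e | i)
      · exact Submodule.subset_span ⟨_, rfl⟩
      · exact slepianBridge_mem_span B _
    · have hi : (τ i : ℝ) ≤ 1 := hτ i
      have h0 := (τ i).coe_nonneg
      set e' : ℝ≥0 := bif e then 1 else 0
      have he' : e' ≤ 1 := by cases e <;> simp [e']
      change cov[slepianProcess B e', fun ω ↦ (slepianProcess B (τ i) ω -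
        (1 - (τ i : ℝ)) * slepianProcess B 0 ω) - (τ i : ℝ) * slepianProcess B 1 ω; P] = 0
      have hL2 : MemLp (fun ω ↦ slepianProcess B (τ i) ω -
          (1 - (τ i : ℝ)) * slepianProcess B 0 ω) 2 P := (hL _).sub (hL' _ _)
      rw [covariance_fun_sub_right (hL _) hL2 (hL' _ _),
        covariance_fun_sub_right (hL _) (hL _) (hL' _ _), covariance_const_mul_right,
        covariance_const_mul_right, covariance_slepianProcess hB he' (hτ i),
        covariance_slepianProcess hB he' zero_le_one, covariance_slepianProcess hB he' le_rfl]
      cases e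
      · simp [e', abs_of_nonneg h0]
      · simp [e', abs_of_nonneg (sub_nonneg.2 hi)]
  exact key.comp (φ := fun f : Bool → ℝ ↦ (f false, f true)) (ψ := id) (by fun_prop) measurable_id

lemma indepFun_slepianProcess_zero_one [IsProbabilityMeasure P] (hB : IsPreBrownianReal B P) :
    IndepFun (slepianProcess B 0) (slepianProcess B 1) P := by
  refine (isGaussianProcess_slepianProcess hB).hasGaussianLaw_prodMk.indepFun_of_covariance_eq_zero
    ?_
  rw [covariance_slepianProcess hB zero_le_one le_rfl]
  simp

lemma map_slepianProcess_zero_one [IsProbabilityMeasure P] (hB : IsPreBrownianReal B P) :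
    P.map (fun ω ↦ (slepianProcess B 0 ω, slepianProcess B 1 ω)) =
      (gaussianReal 0 1).prod (gaussianReal 0 1) := by
  rw [(indepFun_slepianProcess_zero_one hB).map_prod_eq_prod_map_map
    (aemeasurable_slepianProcess hB _) (aemeasurable_slepianProcess hB _),
    map_slepianProcess hB, map_slepianProcess hB]

/-- The Slepian process started from `0`. On `[0, 1]` it has the law of `√2` times a Brownian
motion. -/
noncomputable def slepianIncrement (B : ℝ≥0 → Ω → ℝ) (t : ℝ≥0) (ω : Ω) : ℝ :=
  slepianProcess B t ω - slepianProcess B 0 ω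

lemma aemeasurable_slepianIncrement (hB : IsPreBrownianReal B P) (t : ℝ≥0) :
    AEMeasurable (slepianIncrement B t) P :=
  (aemeasurable_slepianProcess hB t).sub (aemeasurable_slepianProcess hB 0)

lemma slepianIncrement_eq_slepianBridge_add (t : ℝ≥0) (ω : Ω) :
    slepianIncrement B t ω = slepianBridge B t ω + t * slepianIncrement B 1 ω := by
  simp only [slepianIncrement, slepianBridge]
  ring

lemma map_slepianIncrement_one [IsProbabilityMeasure P] (hB : IsPreBrownianReal B P) :
    P.map (slepianIncrement B 1) = gaussianReal 0 2 := by
  have h := gaussianReal_add_gaussianReal_of_indepFun (X := slepianProcess B 1)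
    (Y := Neg.neg (slepianProcess B 0)) (m₁ := 0) (m₂ := 0) (v₁ := 1) (v₂ := 1) (P := P)
    ((indepFun_slepianProcess_zero_one hB).symm.comp measurable_id measurable_neg)
    (map_slepianProcess hB 1) (by
      have := gaussianReal_neg ⟨aemeasurable_slepianProcess hB 0, map_slepianProcess hB 0⟩
      simpa using this.map_eq)
  rw [add_zero, one_add_one_eq_two] at h
  rw [← h]
  congr 1

lemma map_slepianProcess_sub_eq_map_neg (hB : IsPreBrownianReal B P)
    (s t : ℝ≥0) : P.map (slepianProcess B s - slepianProcess B t) =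
      P.map (-(slepianProcess B s - slepianProcess B t)) := by
  have h := (isGaussianProcess_slepianProcess hB).hasGaussianLaw_sub (s := s) (t := t)
  have hmean : P[slepianProcess B s - slepianProcess B t] = 0 := by
    have hi (u : ℝ≥0) : Integrable (slepianProcess B u) P :=
      ((isGaussianProcess_slepianProcess hB).hasGaussianLaw_eval u).integrable
    simp only [Pi.sub_apply]
    rw [integral_sub (hi _) (hi _), integral_slepianProcess hB, integral_slepianProcess hB,
      sub_zero]
  have hmap := h.map_eq_gaussianReal
  rw [hmean] at hmap
  have hneg := gaussianReal_neg ⟨h.aemeasurable, hmap⟩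
  rw [hmap, hneg.map_eq, neg_zero]

lemma indepFun_slepianIncrement_sub [IsProbabilityMeasure P] (hB : IsPreBrownianReal B P)
    {ι : Type*} {τ : ι → ℝ≥0} {t : ℝ≥0} (hτ : ∀ i, τ i ≤ t) (ht : t ≤ 1) :
    IndepFun (fun ω i ↦ slepianIncrement B (τ i) ω)
      (slepianProcess B 1 - slepianProcess B t) P := by
  have hL := memLp_slepianProcess hB
  have key : IndepFun (fun ω i ↦ slepianIncrement B (τ i) ω)
      (fun ω (_ : Unit) ↦ (slepianProcess B 1 - slepianProcess B t) ω) P := by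
    refine IsGaussianProcess.indepFun_of_covariance_eq_zero
      (X := fun i ω ↦ slepianIncrement B (τ i) ω)
      (Y := fun (_ : Unit) ω ↦ (slepianProcess B 1 - slepianProcess B t) ω)
      (isGaussianProcess_of_mem_span (isGaussianProcess_slepianProcess hB) ?_)
      (fun _ ↦ aemeasurable_slepianIncrement hB _)
      (fun _ ↦ (aemeasurable_slepianProcess hB _).sub (aemeasurable_slepianProcess hB _))
      fun i _ ↦ ?_
    · rintro (i | _) <;>
      exact Submodule.sub_mem _ (Submodule.subset_span ⟨_, rfl⟩) (Submodule.subset_span ⟨_, rfl⟩)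
    · have h1 : τ i ≤ 1 := (hτ i).trans ht
      have h0 := (τ i).coe_nonneg
      have ht0 := t.coe_nonneg
      have hit : (τ i : ℝ) ≤ t := hτ i
      have ht1 : (t : ℝ) ≤ 1 := ht
      change cov[fun ω ↦ slepianProcess B (τ i) ω - slepianProcess B 0 ω,
        fun ω ↦ slepianProcess B 1 ω - slepianProcess B t ω; P] = 0
      rw [covariance_fun_sub_fun_sub (hL _) (hL _) (hL _) (hL _)]
      have hc {u v : ℝ≥0} (hu : u ≤ 1) (hv : v ≤ 1) := covariance_slepianProcess hB hu hv
      change cov[slepianProcess B _, slepianProcess B _; P]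
        - cov[slepianProcess B _, slepianProcess B _; P]
        - cov[slepianProcess B _, slepianProcess B _; P]
        + cov[slepianProcess B _, slepianProcess B _; P] = 0
      rw [hc h1 le_rfl, hc h1 ht, hc zero_le_one le_rfl, hc zero_le_one ht,
        abs_of_nonpos (by simpa using hit.trans ht1), abs_of_nonpos (by linarith)]
      simp only [NNReal.coe_one, NNReal.coe_zero, zero_sub, abs_neg, abs_one, abs_of_nonneg ht0]
      ring
  exact key.comp (φ := id) (ψ := fun f : Unit → ℝ ↦ f ()) measurable_id (by fun_prop)

/-! ### The reflection principle -/

lemma nullMeasurableSet_exists_lt_slepianIncrement (hB : IsPreBrownianReal B P) (m : ℝ) :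
    NullMeasurableSet {ω | ∃ i, m < slepianIncrement B (gridTime i) ω} P := by
  simp only [ofPred_exists]
  exact NullMeasurableSet.iUnion fun i ↦
    nullMeasurableSet_lt aemeasurable_const (aemeasurable_slepianIncrement hB _)

/-- The event of a first exceedance at the `k`-th grid point depends only on the path up to that
point. -/
lemma exists_measurableSet_isFirstExceedance_iff (m : ℝ) (n k : ℕ) :
    ∃ C : Set (Fin (k + 1) → ℝ), MeasurableSet C ∧ ∀ v : ℝ≥0 → ℝ,
      IsFirstExceedance m v n k ↔
        (fun j : Fin (k + 1) ↦ v (((j : ℕ) : ℝ≥0) / (n + 1))) ∈ C := by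
  refine ⟨{p | m < p (Fin.last k)} ∩ ⋂ j : Fin k, {p | p j.castSucc ≤ m}, ?_, fun v ↦ ?_⟩
  · exact (measurableSet_lt measurable_const (measurable_pi_apply _)).inter
      (MeasurableSet.iInter fun j ↦ measurableSet_le (measurable_pi_apply _) measurable_const)
  · simp only [IsFirstExceedance, mem_inter_iff, mem_ofPred_eq, Fin.val_last, mem_iInter,
      Fin.val_castSucc]
    exact and_congr_right fun _ ↦ ⟨fun h j ↦ h j j.2, fun h j hj ↦ h ⟨j, hj⟩⟩

lemma aemeasurable_indicator_firstExceedance (hB : IsPreBrownianReal B P) (m : ℝ) (n k : ℕ)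
    {g : ℝ × ℝ → ℝ} (hg : Measurable g) :
    AEMeasurable (fun ω ↦ {v | IsFirstExceedance m v n k}.indicator
      (fun v ↦ g (v (k / (n + 1)), slepianIncrement B 1 ω)) (slepianIncrement B · ω)) P := by
  obtain ⟨C, hC, hCv⟩ := exists_measurableSet_isFirstExceedance_iff m n k
  have h1 : AEMeasurable (fun ω (j : Fin (k + 1)) ↦
      slepianIncrement B (((j : ℕ) : ℝ≥0) / (n + 1)) ω) P :=
    aemeasurable_pi_lambda _ fun j ↦ aemeasurable_slepianIncrement hB _
  have h2 : Measurable (fun q : (Fin (k + 1) → ℝ) × ℝ ↦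
      (C ×ˢ univ).indicator (fun q ↦ g (q.1 (Fin.last k), q.2)) q) :=
    (hg.comp (by fun_prop)).indicator (hC.prod .univ)
  refine (h2.comp_aemeasurable (h1.prodMk (aemeasurable_slepianIncrement hB 1))).congr
    (ae_of_all _ fun ω ↦ ?_)
  by_cases h : IsFirstExceedance m (slepianIncrement B · ω) n k
  · simp [indicator, h, (hCv _).1 h]
  · simp [indicator, h, mt (hCv _).2 h]

/-- Reflecting the path after its first exceedance of the level `m` on the grid does not change its
law. -/
lemma integral_indicator_firstExceedance_reflect [IsProbabilityMeasure P]
    (hB : IsPreBrownianReal B P) (m : ℝ) {n k : ℕ} (hk : k ≤ n + 1) {g : ℝ → ℝ}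
    (hg : Measurable g) :
    ∫ ω, {v | IsFirstExceedance m v n k}.indicator
        (fun _ ↦ g (slepianIncrement B 1 ω)) (slepianIncrement B · ω) ∂P =
      ∫ ω, {v | IsFirstExceedance m v n k}.indicator
        (fun v ↦ g (2 * v (k / (n + 1)) - slepianIncrement B 1 ω)) (slepianIncrement B · ω) ∂P := by
  obtain ⟨C, hC, hCv⟩ := exists_measurableSet_isFirstExceedance_iff m n k
  have hΨ : Measurable (fun q : (Fin (k + 1) → ℝ) × ℝ ↦
      (C ×ˢ univ).indicator (fun q ↦ g (q.1 (Fin.last k) + q.2)) q) :=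
    (hg.comp (by fun_prop)).indicator (hC.prod .univ)
  have hind := indepFun_slepianIncrement_sub hB (ι := Fin (k + 1))
    (τ := fun j ↦ ((j : ℕ) : ℝ≥0) / (n + 1)) (t := k / (n + 1)) (fun j ↦ by
      gcongr
      omega) (grid_le_one hk)
  have h := integral_comp_prodMk_neg_of_indepFun
    (aemeasurable_pi_lambda _ fun j ↦ aemeasurable_slepianIncrement hB _)
    ((aemeasurable_slepianProcess hB _).sub (aemeasurable_slepianProcess hB _)) hind
    (map_slepianProcess_sub_eq_map_neg hB _ _) hΨ
  -- With `U` the increment from the `k`-th grid point to time `1`, the endpoint of the path is its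
  -- value at the grid point plus `U`, and the reflected endpoint is that value minus `U`.
  convert h using 3 with ω ω
  all_goals
    by_cases h : IsFirstExceedance m (slepianIncrement B · ω) n k
    · rw [indicator_of_mem (s := {v | IsFirstExceedance m v n k}) h,
        indicator_of_mem (s := C ×ˢ univ) ⟨(hCv _).1 h, trivial⟩]
      congr 1
      simp only [slepianIncrement, Pi.sub_apply, Fin.val_last]
      ring
    · simp [indicator, h, mt (hCv _).2 h]

lemma continuous_slepianIncrement {ω : Ω} (h : Continuous (B · ω)) :
    Continuous (slepianIncrement B · ω) := by
  simp only [slepianIncrement, slepianProcess]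
  fun_prop

/-- As the mesh tends to `0`, the value of the path at its first exceedance of `m` on the grid is
replaced by `m`, on the event that the path exceeds `m` at all. -/
lemma tendsto_integral_sum_indicator_firstExceedance [IsProbabilityMeasure P]
    (hB : IsBrownianReal B P) {m : ℝ} (hm : 0 < m) {g : ℝ × ℝ → ℝ} (hg : Continuous g) {C : ℝ}
    (hC : ∀ x, |g x| ≤ C) :
    Tendsto (fun n : ℕ ↦ ∫ ω, ∑ k ∈ Finset.range (n + 2),
      {v | IsFirstExceedance m v n k}.indicator
        (fun v ↦ g (v (k / (n + 1)), slepianIncrement B 1 ω)) (slepianIncrement B · ω) ∂P)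
      atTop (𝓝 (∫ ω in {ω | ∃ i, m < slepianIncrement B (gridTime i) ω},
        g (m, slepianIncrement B 1 ω) ∂P)) := by
  rw [← integral_indicator₀
    (nullMeasurableSet_exists_lt_slepianIncrement hB.toIsPreBrownianReal m)]
  refine tendsto_integral_of_dominated_convergence (fun _ ↦ C) (fun n ↦ ?_) (integrable_const C)
    (fun n ↦ ae_of_all _ fun ω ↦ ?_) ?_
  · exact (Finset.aemeasurable_fun_sum _ fun k _ ↦ aemeasurable_indicator_firstExceedance
      hB.toIsPreBrownianReal m n k hg.measurable).aestronglyMeasurable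
  · exact abs_sum_indicator_firstExceedance_le
      (h := fun x ↦ g (x, slepianIncrement B 1 ω)) (fun x ↦ hC _) n _
  · filter_upwards [hB.cont] with ω hω
    have hv := continuous_slepianIncrement hω
    by_cases h : ∃ i, m < slepianIncrement B (gridTime i) ω
    · rw [indicator_of_mem (s := {ω | ∃ i, m < slepianIncrement B (gridTime i) ω}) h]
      refine tendsto_sum_indicator_firstExceedance
        (h := fun x ↦ g (x, slepianIncrement B 1 ω)) hv ?_ ?_ ?_
      · simpa [slepianIncrement] using hm.le
      · obtain ⟨i, hi⟩ := h
        exact ⟨_, ⟨zero_le, gridTime_le_one i⟩, hi⟩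
      · exact Continuous.continuousAt (by fun_prop)
    · rw [indicator_of_notMem (s := {ω | ∃ i, m < slepianIncrement B (gridTime i) ω}) h]
      push Not at h
      have h' := (forall_gridTime_le_iff hv).1 h
      refine tendsto_const_nhds.congr fun n ↦ ?_
      exact (sum_indicator_firstExceedance_eq_zero h'
        (fun x ↦ g (x, slepianIncrement B 1 ω)) n).symm

/-- The **reflection principle** at the level `m > 0`: on the event that the path exceeds `m` before
time `1`, its endpoint and the reflection of its endpoint at `m` have the same law. The laws are
tested against bounded continuous functions, for which the reflection on grids passes to the limit. -/
theorem map_slepianIncrement_restrict_eq_reflect [IsProbabilityMeasure P]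
    (hB : IsBrownianReal B P) {m : ℝ} (hm : 0 < m) :
    (P.restrict {ω | ∃ i, m < slepianIncrement B (gridTime i) ω}).map (slepianIncrement B 1) =
      (P.restrict {ω | ∃ i, m < slepianIncrement B (gridTime i) ω}).map
        (fun ω ↦ 2 * m - slepianIncrement B 1 ω) := by
  have hpre := hB.toIsPreBrownianReal
  have hV := (aemeasurable_slepianIncrement hpre 1).restrict
    (s := {ω | ∃ i, m < slepianIncrement B (gridTime i) ω})
  refine ext_of_forall_integral_eq_of_IsFiniteMeasure fun f ↦ ?_
  have hfC (x : ℝ) : |f x| ≤ ‖f‖ := f.norm_coe_le_norm x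
  rw [integral_map hV f.continuous.aestronglyMeasurable,
    integral_map (hV.const_sub _) f.continuous.aestronglyMeasurable]
  refine tendsto_nhds_unique (tendsto_integral_sum_indicator_firstExceedance hB hm
    (g := fun q ↦ f q.2) (by fun_prop) (fun _ ↦ hfC _)) ?_
  refine (tendsto_integral_sum_indicator_firstExceedance hB hm
    (g := fun q ↦ f (2 * q.1 - q.2)) (by fun_prop) (fun _ ↦ hfC _)).congr fun n ↦ ?_
  have hint {g : ℝ × ℝ → ℝ} (hg : Measurable g) (hgC : ∀ x, |g x| ≤ ‖f‖) (k : ℕ) :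
      Integrable (fun ω ↦ {v | IsFirstExceedance m v n k}.indicator
        (fun v ↦ g (v (k / (n + 1)), slepianIncrement B 1 ω)) (slepianIncrement B · ω)) P := by
    refine Integrable.of_bound
      (aemeasurable_indicator_firstExceedance hpre m n k hg).aestronglyMeasurable ‖f‖
      (ae_of_all _ fun ω ↦ ?_)
    simpa using abs_sum_indicator_firstExceedance_le (m := m)
      (h := fun x ↦ g (x, slepianIncrement B 1 ω)) (fun _ ↦ hgC _) n {k}
      (v := (slepianIncrement B · ω))
  rw [integral_finsetSum _ fun k _ ↦ hint (g := fun q ↦ f (2 * q.1 - q.2))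
      (Continuous.measurable (by fun_prop)) (fun _ ↦ hfC _) k,
    integral_finsetSum _ fun k _ ↦ hint (g := fun q ↦ f q.2)
      (Continuous.measurable (by fun_prop)) (fun _ ↦ hfC _) k]
  refine Finset.sum_congr rfl fun k hk ↦ ?_
  have := Finset.mem_range.1 hk
  exact (integral_indicator_firstExceedance_reflect hpre m (by omega)
    f.continuous.measurable).symm

/-! ### Crossing probability of the bridge and of the Slepian process -/

/-- The probability that the bridge from `0` to `v` of `√2` times a Brownian motion exceeds the level
`m` at some time of `[0, 1]`. Restricting to countably many times makes the event measurable in the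
product space of paths. -/
noncomputable def bridgeCrossingProb (B : ℝ≥0 → Ω → ℝ) (P : Measure Ω) (m v : ℝ) : ℝ≥0∞ :=
  P.map (fun ω (i : ℕ × ℕ) ↦ slepianBridge B (gridTime i) ω)
    {β | ∃ i, m < β i + gridTime i * v}

lemma measurableSet_bridge_crossing {α : Type*} [MeasurableSpace α] {f g : α → ℝ}
    (hf : Measurable f) (hg : Measurable g) :
    MeasurableSet {q : α × (ℕ × ℕ → ℝ) | ∃ i, f q.1 < q.2 i + gridTime i * g q.1} := by
  simp only [ofPred_exists]
  exact MeasurableSet.iUnion fun i ↦ measurableSet_lt (by fun_prop) (by fun_prop)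

lemma aemeasurable_slepianBridge_gridTime (hB : IsPreBrownianReal B P) :
    AEMeasurable (fun ω (i : ℕ × ℕ) ↦ slepianBridge B (gridTime i) ω) P :=
  aemeasurable_pi_lambda _ fun _ ↦ aemeasurable_slepianBridge hB _

lemma measurable_bridgeCrossingProb [IsProbabilityMeasure P] (m : ℝ) :
    Measurable (bridgeCrossingProb B P m) :=
  measurable_measure_prodMk_left (measurableSet_bridge_crossing measurable_const measurable_id)

/-- Disintegration with respect to the value of a variable `Z` that is independent of the bridge;
the level `f Z` and the endpoint `g Z` may depend on it. -/
lemma measure_mem_inter_bridge_crossing [IsProbabilityMeasure P] (hB : IsPreBrownianReal B P)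
    {α : Type*} [MeasurableSpace α] {Z : Ω → α} (hZ : AEMeasurable Z P)
    (hind : IndepFun Z (fun ω (i : ℕ × ℕ) ↦ slepianBridge B (gridTime i) ω) P)
    {f g : α → ℝ} (hf : Measurable f) (hg : Measurable g) {K : Set α} (hK : MeasurableSet K) :
    P {ω | Z ω ∈ K ∧ ∃ i, f (Z ω) < slepianBridge B (gridTime i) ω + gridTime i * g (Z ω)} =
      ∫⁻ z in K, bridgeCrossingProb B P (f z) (g z) ∂P.map Z := by
  have hb := aemeasurable_slepianBridge_gridTime hB
  have hE := ((hK.prod .univ).inter (measurableSet_bridge_crossing hf hg))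
  have hprob := Measure.isProbabilityMeasure_map hb
  have h := Measure.map_apply_of_aemeasurable (hZ.prodMk hb) hE
  rw [hind.map_prod_eq_prod_map_map hZ hb, Measure.prod_apply hE] at h
  have hpre : {ω | Z ω ∈ K ∧
      ∃ i, f (Z ω) < slepianBridge B (gridTime i) ω + gridTime i * g (Z ω)} =
      (fun ω ↦ (Z ω, fun i : ℕ × ℕ ↦ slepianBridge B (gridTime i) ω)) ⁻¹'
        (K ×ˢ univ ∩ {q | ∃ i, f q.1 < q.2 i + gridTime i * g q.1}) := by
    ext ω
    simp
  rw [hpre, ← h, ← lintegral_indicator hK]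
  refine lintegral_congr fun z ↦ ?_
  by_cases hz : z ∈ K
  · rw [indicator_of_mem hz, bridgeCrossingProb]
    congr 1
    ext β
    simp [hz]
  · rw [indicator_of_notMem hz]
    simp [hz]

/-- The density of the reflected Gaussian with respect to the Gaussian of variance `2`. -/
lemma gaussianReal_preimage_reflect (m : ℝ) {K : Set ℝ} (hK : MeasurableSet K) :
    gaussianReal 0 2 ((fun v ↦ 2 * m - v) ⁻¹' K) =
      ∫⁻ v in K, ENNReal.ofReal (Real.exp (-(m * (m - v)))) ∂gaussianReal 0 2 := by
  rw [← Measure.map_apply (by fun_prop) hK, gaussianReal_map_const_sub,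
    gaussianReal_of_var_ne_zero _ two_ne_zero, gaussianReal_of_var_ne_zero _ two_ne_zero,
    withDensity_apply _ hK, setLIntegral_withDensity_eq_setLIntegral_mul _
      (measurable_gaussianPDF _ _) (by fun_prop) hK]
  refine setLIntegral_congr_fun hK fun v _ ↦ ?_
  simp only [Pi.mul_apply, gaussianPDF]
  rw [← ENNReal.ofReal_mul (gaussianPDFReal_nonneg _ _ _)]
  congr 1
  simp only [gaussianPDFReal]
  rw [mul_assoc _ (Real.exp _) (Real.exp _), ← Real.exp_add]
  congr 2
  push_cast
  ring

/-- The crossing probability of a Brownian bridge, obtained by conditioning the reflection principle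
on the endpoint of the path. -/
lemma bridgeCrossingProb_ae_eq [IsProbabilityMeasure P] (hB : IsBrownianReal B P) {m : ℝ}
    (hm : 0 < m) : ∀ᵐ v : ℝ, v < m →
      bridgeCrossingProb B P m v = ENNReal.ofReal (Real.exp (-(m * (m - v)))) := by
  have hpre := hB.toIsPreBrownianReal
  have hV := aemeasurable_slepianIncrement hpre 1
  have hind : IndepFun (slepianIncrement B 1)
      (fun ω (i : ℕ × ℕ) ↦ slepianBridge B (gridTime i) ω) P :=
    (indepFun_slepianBridge_endpoints hpre gridTime_le_one).comp
      (φ := fun p : ℝ × ℝ ↦ p.2 - p.1) (ψ := id) (by fun_prop) measurable_id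
  -- Both sides are densities with respect to the law of the endpoint, on the half-line below `m`.
  refine (gaussianReal_absolutelyContinuous' 0 two_ne_zero).ae_le
    ((ae_restrict_iff' (measurableSet_Iio (a := m))).1 ?_)
  refine ae_eq_of_forall_setLIntegral_eq_of_sigmaFinite (measurable_bridgeCrossingProb m)
    (by fun_prop) fun K hK _ ↦ ?_
  rw [Measure.restrict_restrict hK, ← gaussianReal_preimage_reflect m (hK.inter measurableSet_Iio),
    ← map_slepianIncrement_one hpre,
    ← measure_mem_inter_bridge_crossing hpre hV hind (f := fun _ ↦ m) (g := fun v ↦ v)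
      measurable_const measurable_id (hK.inter measurableSet_Iio),
    Measure.map_apply_of_aemeasurable hV ((hK.inter measurableSet_Iio).preimage (by fun_prop))]
  have hrefl := congrArg (fun μ ↦ μ (K ∩ Iio m)) (map_slepianIncrement_restrict_eq_reflect hB hm)
  rw [Measure.map_apply_of_aemeasurable hV.restrict (hK.inter measurableSet_Iio),
    Measure.map_apply_of_aemeasurable (hV.restrict.const_sub _) (hK.inter measurableSet_Iio),
    Measure.restrict_apply₀' (nullMeasurableSet_exists_lt_slepianIncrement hpre m),
    Measure.restrict_apply₀' (nullMeasurableSet_exists_lt_slepianIncrement hpre m)] at hrefl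
  convert hrefl using 2
  · ext ω
    simp only [← slepianIncrement_eq_slepianBridge_add]
    rfl
  · -- A path whose endpoint is reflected below the level `m` has crossed that level by time `1`.
    refine Subset.antisymm (fun ω hω ↦ ⟨hω, (0, 1), ?_⟩) inter_subset_left
    have hlt : 2 * m - slepianIncrement B 1 ω < m := hω.2
    rw [gridTime_zero_one]
    linarith

/-- The probability that the Slepian process starts and ends below `a` but exceeds `a` in between:
given its endpoints `x` and `y`, the process is a bridge, which has to exceed `a - x` on its way to
`y - x`. -/
lemma measure_exists_lt_slepianProcess_inter [IsProbabilityMeasure P] (hB : IsBrownianReal B P)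
    (a : ℝ) :
    P {ω | (slepianProcess B 0 ω ≤ a ∧ slepianProcess B 1 ω ≤ a) ∧
      ∃ i, a < slepianProcess B (gridTime i) ω} =
      ENNReal.ofReal (stdNormalPDF a * (a * stdNormalCDF a + stdNormalPDF a)) := by
  have hpre := hB.toIsPreBrownianReal
  have hZ : AEMeasurable (fun ω ↦ (slepianProcess B 0 ω, slepianProcess B 1 ω)) P :=
    (aemeasurable_slepianProcess hpre 0).prodMk (aemeasurable_slepianProcess hpre 1)
  have hset : {ω | (slepianProcess B 0 ω ≤ a ∧ slepianProcess B 1 ω ≤ a) ∧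
      ∃ i, a < slepianProcess B (gridTime i) ω} =
      {ω | (slepianProcess B 0 ω, slepianProcess B 1 ω) ∈ Iic a ×ˢ Iic a ∧
        ∃ i, a - slepianProcess B 0 ω < slepianBridge B (gridTime i) ω +
          gridTime i * (slepianProcess B 1 ω - slepianProcess B 0 ω)} := by
    ext ω
    refine and_congr Iff.rfl (exists_congr fun i ↦ ?_)
    change _ ↔ _ < _ + _ * slepianIncrement B 1 ω
    rw [← slepianIncrement_eq_slepianBridge_add, slepianIncrement, sub_lt_sub_iff_right]
  have hmeas : Measurable fun p : ℝ × ℝ ↦ bridgeCrossingProb B P (a - p.1) (p.2 - p.1) :=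
    measurable_measure_prodMk_left
      (measurableSet_bridge_crossing (f := fun p : ℝ × ℝ ↦ a - p.1)
        (g := fun p : ℝ × ℝ ↦ p.2 - p.1) (by fun_prop) (by fun_prop))
  rw [hset, measure_mem_inter_bridge_crossing hpre hZ
      (indepFun_slepianBridge_endpoints hpre gridTime_le_one)
      (f := fun p ↦ a - p.1) (g := fun p ↦ p.2 - p.1) (by fun_prop) (by fun_prop)
      (measurableSet_Iic.prod measurableSet_Iic),
    map_slepianProcess_zero_one hpre, ← Measure.prod_restrict, lintegral_prod _ hmeas.aemeasurable,
    ← lintegral_gaussianReal_exp_bridge]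
  have hae {p : ℝ → Prop} (h : ∀ᵐ x : ℝ, p x) : ∀ᵐ x ∂(gaussianReal 0 1), p x :=
    (gaussianReal_absolutelyContinuous 0 one_ne_zero).ae_le h
  have hne : ∀ᵐ x : ℝ, x ≠ a := by simp [ae_iff]
  refine lintegral_congr_ae ((ae_restrict_iff' measurableSet_Iic).2 ?_)
  filter_upwards [hae hne] with x hxa hx
  have hx' : x < a := lt_of_le_of_ne hx hxa
  refine lintegral_congr_ae ((ae_restrict_iff' measurableSet_Iic).2 ?_)
  have hcross := (measurePreserving_sub_right volume x).quasiMeasurePreserving.ae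
    (bridgeCrossingProb_ae_eq hB (sub_pos.2 hx'))
  filter_upwards [hae hne, hae hcross] with y hya hy hyle
  rw [hy (sub_lt_sub_right (lt_of_le_of_ne hyle hya) x), sub_sub_sub_cancel_right]

end Slepian

theorem theorem3p1 {Ω : Type*} [MeasurableSpace Ω] (P : Measure Ω) [IsProbabilityMeasure P]
    (B : ℝ≥0 → Ω → ℝ) (hB : IsBrownianReal B P) (a : ℝ) :
    NullMeasurableSet {ω | ∀ t ∈ Set.Icc (0 : ℝ≥0) 1, slepianProcess B t ω ≤ a} P ∧
    P.real {ω | ∀ t ∈ Set.Icc (0 : ℝ≥0) 1, slepianProcess B t ω ≤ a} =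
      stdNormalCDF a ^ 2 - a * stdNormalPDF a * stdNormalCDF a - stdNormalPDF a ^ 2 := by
  have hpre := hB.toIsPreBrownianReal
  have hS := aemeasurable_slepianProcess hpre
  have hgood : {ω | ∀ t ∈ Set.Icc (0 : ℝ≥0) 1, slepianProcess B t ω ≤ a} =ᵐ[P]
      {ω | ∀ i, slepianProcess B (gridTime i) ω ≤ a} := by
    filter_upwards [hB.cont] with ω hω
    have hv : Continuous (slepianProcess B · ω) := by
      simp only [slepianProcess]
      fun_prop
    exact propext (forall_gridTime_le_iff hv).symm
  have hbadm : NullMeasurableSet {ω | ∃ i, a < slepianProcess B (gridTime i) ω} P := by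
    simp only [ofPred_exists]
    exact NullMeasurableSet.iUnion fun i ↦ nullMeasurableSet_lt aemeasurable_const (hS _)
  have hcompl : {ω | ∀ i, slepianProcess B (gridTime i) ω ≤ a} =
      {ω | ∃ i, a < slepianProcess B (gridTime i) ω}ᶜ := by
    ext ω
    simp
  refine ⟨(hcompl ▸ hbadm.compl).congr hgood.symm, ?_⟩
  rw [measureReal_congr hgood]
  have hends : P.real {ω | slepianProcess B 0 ω ≤ a ∧ slepianProcess B 1 ω ≤ a} =
      stdNormalCDF a ^ 2 := by
    have h := Measure.map_apply_of_aemeasurable ((hS 0).prodMk (hS 1))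
      ((measurableSet_Iic (a := a)).prod (measurableSet_Iic (a := a)))
    rw [map_slepianProcess_zero_one hpre, Measure.prod_prod, gaussianReal_Iic,
      ← ENNReal.ofReal_mul (stdNormalCDF_nonneg a), ← sq] at h
    rw [measureReal_def, ← ENNReal.toReal_ofReal (sq_nonneg (stdNormalCDF a)), h]
    rfl
  have hsplit := measureReal_inter_add_sdiff₀ (μ := P)
    (s := {ω | slepianProcess B 0 ω ≤ a ∧ slepianProcess B 1 ω ≤ a}) hbadm
  have hbad : P.real ({ω | slepianProcess B 0 ω ≤ a ∧ slepianProcess B 1 ω ≤ a} ∩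
      {ω | ∃ i, a < slepianProcess B (gridTime i) ω}) =
      stdNormalPDF a * (a * stdNormalCDF a + stdNormalPDF a) := by
    have h := measure_exists_lt_slepianProcess_inter hB a
    rw [measureReal_def]
    refine (congrArg ENNReal.toReal h).trans (ENNReal.toReal_ofReal ?_)
    refine mul_nonneg (stdNormalPDF_pos a).le ?_
    linarith [neg_mul_stdNormalCDF_le a]
  have hdiff : {ω | slepianProcess B 0 ω ≤ a ∧ slepianProcess B 1 ω ≤ a} \
      {ω | ∃ i, a < slepianProcess B (gridTime i) ω} =
      {ω | ∀ i, slepianProcess B (gridTime i) ω ≤ a} := by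
    rw [hcompl, sdiff_eq, inter_eq_right, ← hcompl]
    intro ω hω
    exact ⟨gridTime_zero_zero ▸ hω (0, 0), gridTime_zero_one ▸ hω (0, 1)⟩
  rw [hdiff, hbad, hends] at hsplit
  linarith
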